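/- Let $2^\omega$ be the Cantor space with the product topology, coordinatewise addition modulo $2$ and the standard product measure. Let $\mathcal N$ be the ideal of null subsets of $2^\omega$, and let $\operatorname{cov}(\mathcal N)$ be the least cardinality of a family of null sets whose union is $2^\omega$. A set $X\subseteq 2^\omega$ is called strongly meager if $X+H\neq 2^\omega$ for every $H\in\mathcal N$, where $X+H=\{x+h : x\in X,\ h\in H\}$. Theorem. Assume that $\operatorname{cov}(\mathcal N)=2^{\aleph_0}$. Then there exist a strongly meager set $X\subseteq 2^\omega$ and a continuous function $F:2^\omega\to 2^\omega$ such that $F[X]=2^\omega$. In particular, such $X$ and $F$ exist under the Continuum Hypothesis $2^{\aleph_0}=\aleph_1$. -/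

import Mathlib

open MeasureTheory
open scoped Pointwise Cardinal

/-- The Cantor space `2^ω`, with the product topology, the product `σ`-algebra and coordinatewise
addition modulo 2. -/
abbrev CantorGroup : Type := ℕ → ZMod 2

/-- The standard product measure on `2^ω`: each coordinate is `0` or `1` with probability `1/2`. -/
noncomputable def cantorMeasure : Measure CantorGroup :=
  Measure.infinitePi fun _ : ℕ => ProbabilityTheory.uniformOn (Set.univ : Set (ZMod 2))

/-- The ideal `𝒩` of null sets: the (not necessarily Borel) sets of outer measure zero. -/
def IsNullSet (A : Set CantorGroup) : Prop :=
  cantorMeasure A = 0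

/-- `cov(𝒩)`: the least cardinality of a family of null sets whose union is `2^ω`. -/
noncomputable def covNull : Cardinal.{0} :=
  sInf {κ : Cardinal.{0} | ∃ 𝒜 : Set (Set CantorGroup),
    (∀ A ∈ 𝒜, IsNullSet A) ∧ ⋃₀ 𝒜 = Set.univ ∧ #𝒜 = κ}

/-- `X` is strongly meager if `X + H ≠ 2^ω` for every null set `H`, where `X + H` is the set of
all sums `x + h` with `x ∈ X` and `h ∈ H`. -/
def IsStronglyMeager (X : Set CantorGroup) : Prop :=
  ∀ H : Set CantorGroup, IsNullSet H → X + H ≠ Set.univ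

/-! The map is `fibreMap`. Coordinates are grouped into blocks `(v, c)`, and its `n`-th output bit
is `c + q v` with `q = dotForm` bent, so its fibres are products of graphs of bent functions, each
parametrised by `fibrePoint z`.

The crux is `ae_forall_ae_add_fibrePoint_notMem`: for null `H`, almost every translation `t` moves
almost all of every fibre off `H`. The null set of bad `t` does not depend on `z`, although there
are uncountably many fibres. This holds because the average of a bounded function over a translated
graph differs from its full average by a correlation with a bent function, which is small in mean
over `t` (`IsBent.expect_abs_le`). Block sizes grow fast enough to pay for the doubling, at each
block, of the number of choices of `z` (`exists_bound_pi`).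

Given this, enumerate the points `z i` and a cofinal family of null sets `H i` in type `𝔠`. Stage
`i` picks a point in the fibre over `z i` and a witness `t` for `H i`, such that no earlier or
current witness plus point lands in the null set of that witness, and likewise for the new witness
with earlier points. Each choice avoids fewer than `𝔠` null sets. The witness for `H i` then lies
outside `X + H i`. -/

open scoped BigOperators

/-! ### Bent functions and their correlations -/

/-- The nontrivial character of `ZMod 2`. -/
def signChar (a : ZMod 2) : ℝ := if a = 0 then 1 else -1

lemma signChar_add (a b : ZMod 2) : signChar (a + b) = signChar a * signChar b := by
  have key : ∀ x : ZMod 2, x = 0 ∨ x = 1 := by decide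
  have h : (1 : ZMod 2) + 1 = 0 := by decide
  rcases key a with rfl | rfl <;> rcases key b with rfl | rfl <;> simp [signChar, h]

lemma signChar_one : signChar 1 = -1 := by simp [signChar]

lemma signChar_mul_self (a : ZMod 2) : signChar a * signChar a = 1 := by
  unfold signChar; split_ifs <;> norm_num

lemma abs_signChar (a : ZMod 2) : |signChar a| = 1 := by
  unfold signChar; split_ifs <;> norm_num

/-- A function `q` on a finite group is bent if `(-1)^q` is orthogonal to each of its nontrivial
translates. -/
def IsBent {V : Type*} [Fintype V] [AddCommGroup V] (q : V → ZMod 2) : Prop :=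
  ∀ d : V, d ≠ 0 → ∑ a, signChar (q a) * signChar (q (a + d)) = 0

/-- The quadratic form `x · y`. -/
def dotForm {ι : Type*} [Fintype ι] (v : (ι → ZMod 2) × (ι → ZMod 2)) : ZMod 2 := v.1 ⬝ᵥ v.2

/-- The derivative of `x · y` in direction `d ≠ 0` is affine and nonconstant; translating by an `e`
on which its linear part is 1 flips the sign of the sum. -/
lemma isBent_dotForm {ι : Type*} [Fintype ι] [DecidableEq ι] :
    IsBent (dotForm : (ι → ZMod 2) × (ι → ZMod 2) → ZMod 2) := by
  intro d hd
  obtain ⟨e, he⟩ : ∃ e : (ι → ZMod 2) × (ι → ZMod 2), e.1 ⬝ᵥ d.2 + d.1 ⬝ᵥ e.2 = 1 := by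
    have key : ∀ x : ZMod 2, x ≠ 0 → x = 1 := by decide
    by_cases h1 : d.1 = 0
    · have h2 : d.2 ≠ 0 := fun h => hd (Prod.ext h1 h)
      obtain ⟨i, hi⟩ := Function.ne_iff.1 h2
      exact ⟨(Pi.single i 1, 0), by simp [key _ hi]⟩
    · obtain ⟨i, hi⟩ := Function.ne_iff.1 h1
      exact ⟨(0, Pi.single i 1), by simp [key _ hi]⟩
  have hq : ∀ a : (ι → ZMod 2) × (ι → ZMod 2),
      signChar (dotForm a) * signChar (dotForm (a + d)) =
        signChar (a.1 ⬝ᵥ d.2 + d.1 ⬝ᵥ a.2 + d.1 ⬝ᵥ d.2) := by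
    intro a
    have : dotForm (a + d) = dotForm a + (a.1 ⬝ᵥ d.2 + d.1 ⬝ᵥ a.2 + d.1 ⬝ᵥ d.2) := by
      simp only [dotForm, Prod.fst_add, Prod.snd_add, add_dotProduct, dotProduct_add]; ring
    rw [this, signChar_add, ← mul_assoc, signChar_mul_self, one_mul]
  simp only [hq]
  set S := ∑ a : (ι → ZMod 2) × (ι → ZMod 2),
    signChar (a.1 ⬝ᵥ d.2 + d.1 ⬝ᵥ a.2 + d.1 ⬝ᵥ d.2) with hS
  have : S = -S := by
    conv_lhs => rw [hS, ← Equiv.sum_comp (Equiv.addRight e)]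
    rw [hS, ← Finset.sum_neg_distrib]
    refine Finset.sum_congr rfl fun a _ => ?_
    have : (a + e).1 ⬝ᵥ d.2 + d.1 ⬝ᵥ (a + e).2 + d.1 ⬝ᵥ d.2 =
        (a.1 ⬝ᵥ d.2 + d.1 ⬝ᵥ a.2 + d.1 ⬝ᵥ d.2) + 1 := by
      rw [← he]
      simp only [Prod.fst_add, Prod.snd_add, add_dotProduct, dotProduct_add]; ring
    rw [Equiv.coe_addRight, this, signChar_add, signChar_one]; ring
  linarith

section Bent

variable {V : Type*} [Fintype V] [AddCommGroup V]

/-- Parseval: the translates of `(-1)^q` are orthogonal, of squared norm `|V|`, and there are `|V|`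
of them. -/
lemma IsBent.sum_sq {q : V → ZMod 2} (hq : IsBent q) (h : V → ℝ) :
    ∑ a, (∑ v, h (a + v) * signChar (q v)) ^ 2 = Fintype.card V * ∑ v, h v ^ 2 := by
  classical
  have h1 : ∀ a, ∑ v, h (a + v) * signChar (q v) = ∑ u, h u * signChar (q (u - a)) := by
    intro a
    rw [← Equiv.sum_comp (Equiv.addLeft a) (fun u => h u * signChar (q (u - a)))]
    simp
  have h2 : ∀ u u' : V, ∑ a, signChar (q (u - a)) * signChar (q (u' - a)) =
      if u' = u then (Fintype.card V : ℝ) else 0 := by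
    intro u u'
    rw [← Equiv.sum_comp (Equiv.subLeft u)]
    simp only [Equiv.subLeft_apply, sub_sub_cancel]
    split_ifs with h
    · subst h
      simp [signChar_mul_self]
    · rw [← hq (u' - u) (sub_ne_zero.2 h)]
      refine Finset.sum_congr rfl fun a _ => ?_
      congr 3; abel
  calc ∑ a, (∑ v, h (a + v) * signChar (q v)) ^ 2
      = ∑ a, ∑ u, ∑ u', h u * h u' * (signChar (q (u - a)) * signChar (q (u' - a))) := by
        refine Finset.sum_congr rfl fun a _ => ?_
        rw [h1, sq, Finset.sum_mul_sum]
        refine Finset.sum_congr rfl fun u _ => Finset.sum_congr rfl fun u' _ => ?_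
        ring
    _ = ∑ u, ∑ u', h u * h u' * ∑ a, signChar (q (u - a)) * signChar (q (u' - a)) := by
        rw [Finset.sum_comm]
        refine Finset.sum_congr rfl fun u _ => ?_
        rw [Finset.sum_comm]
        simp only [Finset.mul_sum]
    _ = _ := by
        simp only [h2, mul_ite, mul_zero, Finset.sum_ite_eq', Finset.mem_univ,
          if_true, Finset.mul_sum]
        refine Finset.sum_congr rfl fun u _ => ?_
        ring

/-- Cauchy–Schwarz applied to `IsBent.sum_sq`; the mean correlation is at most `|V|^(-1/2) / 2`. -/
lemma IsBent.expect_abs_le {q : V → ZMod 2} (hq : IsBent q) {h : V → ℝ} (hh : ∀ v, |h v| ≤ 1 / 2)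
    {c : ℝ} (hc : 0 ≤ c) (hV : 1 ≤ c ^ 2 * Fintype.card V) :
    𝔼 a, |𝔼 v, h (a + v) * signChar (q v)| ≤ c / 2 := by
  have hn : (0 : ℝ) < (Fintype.card V : ℝ) := by exact_mod_cast Fintype.card_pos
  set n : ℝ := (Fintype.card V : ℝ) with hn_def
  have hs : ∑ v, h v ^ 2 ≤ n * (1 / 4) := by
    have : ∀ v ∈ Finset.univ, h v ^ 2 ≤ (1 / 4 : ℝ) := fun v _ => by
      have := sq_le_sq' (by linarith [neg_abs_le (h v), hh v]) ((le_abs_self _).trans (hh v))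
      norm_num at this ⊢; linarith
    simpa using Finset.sum_le_card_nsmul _ _ _ this
  have h1 : (∑ a, |∑ v, h (a + v) * signChar (q v)|) ^ 2 ≤ n * (n * (n * (1 / 4))) := by
    refine sq_sum_le_card_mul_sum_sq.trans ?_
    simp only [sq_abs, hq.sum_sq, Finset.card_univ]
    gcongr
  have h2 : 𝔼 a, |𝔼 v, h (a + v) * signChar (q v)| =
      (∑ a, |∑ v, h (a + v) * signChar (q v)|) / n ^ 2 := by
    simp only [Fintype.expect_eq_sum_div_card, abs_div, Nat.abs_cast, ← Finset.sum_div]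
    rw [div_div, sq]
  rw [h2, div_le_iff₀ (by positivity)]
  refine le_of_sq_le_sq ?_ (by positivity)
  refine h1.trans ?_
  nlinarith [mul_le_mul_of_nonneg_left hV (by positivity : 0 ≤ n ^ 3)]

end Bent

/-! ### Averages over translated fibres in one block -/

/-- The shift of the point `x = (v, c)` moved to the fibre of `(v, c) ↦ c - q v` over `z`. -/
def fibreShift {V : Type*} [AddCommGroup V] (q : V → ZMod 2) (z : ZMod 2) (t x : V × ZMod 2) :
    V × ZMod 2 := (t.1 + x.1, t.2 + (q x.1 + z))

section Level

variable {V : Type*} [Fintype V] [AddCommGroup V]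

lemma expect_zmod_two (f : ZMod 2 → ℝ) : 𝔼 c, f c = (f 0 + f 1) / 2 := by
  rw [Fintype.expect_eq_sum_div_card]
  rw [ZMod.card, show ∑ c, f c = f 0 + f 1 from Fin.sum_univ_two f]
  norm_num

lemma expect_fibreShift_eq (q : V → ZMod 2) (G : V × ZMod 2 → ℝ) (z : ZMod 2) (t : V × ZMod 2) :
    𝔼 x, G (fibreShift q z t x) = 𝔼 x, G x + signChar (t.2 + z) *
      𝔼 v, (G (t.1 + v, 0) - G (t.1 + v, 1)) / 2 * signChar (q v) := by
  have e1 : 𝔼 x, G (fibreShift q z t x) = 𝔼 v, G (t.1 + v, t.2 + (q v + z)) := by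
    rw [← Finset.univ_product_univ, Finset.expect_product]
    simp [fibreShift]
  have e2 : 𝔼 x, G x = 𝔼 v, (G (t.1 + v, 0) + G (t.1 + v, 1)) / 2 := by
    rw [← Finset.univ_product_univ, Finset.expect_product]
    simp only [expect_zmod_two]
    exact (Fintype.expect_equiv (Equiv.addLeft t.1) _ _ fun v => by simp).symm
  rw [e1, e2, Finset.mul_expect, ← Finset.expect_add_distrib]
  refine Finset.expect_congr rfl fun v _ => ?_
  have : signChar (t.2 + z) * signChar (q v) = signChar (t.2 + (q v + z)) := by
    rw [← signChar_add]; congr 1; ring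
  rw [mul_left_comm, this]
  rcases (by decide : ∀ x : ZMod 2, x = 0 ∨ x = 1) (t.2 + (q v + z)) with h | h <;>
    rw [h] <;> simp [signChar] <;> ring

/-- The bit `z` only affects the sign of the correlation term, so its absolute value serves both
fibres; summing over `J` serves all functions at once. -/
lemma exists_bound_fibreShift {q : V → ZMod 2} (hq : IsBent q) {c : ℝ} (hc : 0 ≤ c)
    (hV : 1 ≤ c ^ 2 * Fintype.card V) {J : Type*} [Fintype J] (G : J → V × ZMod 2 → ℝ)
    (hG0 : ∀ j x, 0 ≤ G j x) (hG1 : ∀ j x, G j x ≤ 1) {M : ℝ} (hM : ∀ j, 𝔼 x, G j x ≤ M) :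
    ∃ B : V × ZMod 2 → ℝ, (∀ j z t, 𝔼 x, G j (fibreShift q z t x) ≤ B t) ∧
      𝔼 t, B t ≤ M + Fintype.card J * c := by
  let D : J → V → ℝ := fun j a => |𝔼 v, (G j (a + v, 0) - G j (a + v, 1)) / 2 * signChar (q v)|
  refine ⟨fun t => M + ∑ j, D j t.1, fun j z t => ?_, ?_⟩
  · rw [expect_fibreShift_eq]
    refine add_le_add (hM j) ?_
    refine (le_abs_self _).trans ?_
    rw [abs_mul, abs_signChar, one_mul]
    exact Finset.single_le_sum (f := fun j => D j t.1) (fun _ _ => abs_nonneg _) (Finset.mem_univ j)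
  · rw [← Finset.univ_product_univ, Finset.expect_product]
    simp only [Fintype.expect_const]
    rw [Finset.expect_add_distrib, Fintype.expect_const, Finset.expect_sum_comm]
    gcongr
    rw [← nsmul_eq_mul, ← Finset.card_univ]
    refine Finset.sum_le_card_nsmul _ _ _ fun j _ => ?_
    refine (hq.expect_abs_le (h := fun u => (G j (u, 0) - G j (u, 1)) / 2) ?_ hc hV).trans
      (by linarith)
    intro v
    rw [abs_le]
    constructor <;> linarith [hG0 j (v, 0), hG0 j (v, 1), hG1 j (v, 0), hG1 j (v, 1)]

/-- The fibre takes one of the two bits over each `v`, and a nonnegative value is at most the sum of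
both. -/
lemma expect_fibreShift_le (q : V → ZMod 2) {G : V × ZMod 2 → ℝ} (hG : ∀ x, 0 ≤ G x)
    (z : ZMod 2) (t : V × ZMod 2) : 𝔼 x, G (fibreShift q z t x) ≤ 2 * 𝔼 x, G x := by
  rw [← Fintype.expect_equiv (Equiv.addLeft t) (fun x => G (t + x)) G fun x => rfl,
    ← Finset.univ_product_univ, Finset.expect_product, Finset.expect_product, Finset.mul_expect]
  refine Finset.expect_le_expect fun v _ => ?_
  simp only [fibreShift, Fintype.expect_const, expect_zmod_two]
  have h0 := hG (t.1 + v, t.2)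
  have h1 := hG (t.1 + v, t.2 + 1)
  rcases (by decide : ∀ x : ZMod 2, x = 0 ∨ x = 1) (q v + z) with h | h <;>
    rw [h] <;> simp only [Prod.add_def, add_zero] <;> linarith

end Level

/-! ### Induction over finitely many blocks -/

lemma expect_pi_succ {L : ℕ → Type*} [∀ n, Fintype (L n)] {N : ℕ}
    (f : (∀ i : Fin (N + 1), L i) → ℝ) :
    𝔼 x, f x = 𝔼 a : L 0, 𝔼 y : (∀ i : Fin N, L (i + 1)),
      f (Fin.cons (α := fun i : Fin (N + 1) => L i) a y) := by
  rw [← Finset.expect_product', Finset.univ_product_univ]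
  exact (Fintype.expect_equiv (Fin.consEquiv fun i : Fin (N + 1) => L i) _ _ fun _ => rfl).symm

/-- `k` counts the blocks already treated, and `J` records the choices of `z` on them. The crude
factor 2 is paid on the next `n₀` blocks; from then on the bent estimate costs at most `2^k *
(1/2)^(2k+1) = (1/2)^(k+1)` per block, a geometric series. -/
theorem exists_bound_pi : ∀ (N k n₀ : ℕ) {L : ℕ → Type} [∀ n, Fintype (L n)] [∀ n, Nonempty (L n)]
    (T : ∀ n, ZMod 2 → L n → L n → L n),
    (∀ (n : ℕ) (J : Type) [Fintype J] (G : J → L n → ℝ), (∀ j x, 0 ≤ G j x) → (∀ j x, G j x ≤ 1) →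
      ∀ M : ℝ, (∀ j, 𝔼 x, G j x ≤ M) → ∃ B : L n → ℝ, (∀ j z t, 𝔼 x, G j (T n z t x) ≤ B t) ∧
        𝔼 t, B t ≤ M + Fintype.card J * (1 / 2) ^ (2 * (k + n) + 1)) →
    (∀ (n : ℕ) (G : L n → ℝ), (∀ x, 0 ≤ G x) → ∀ z t, 𝔼 x, G (T n z t x) ≤ 2 * 𝔼 x, G x) →
    ∀ {J : Type} [Fintype J] [Nonempty J], Fintype.card J ≤ 2 ^ k → ∀ G : J → (∀ i : Fin N, L i) → ℝ,
    (∀ j x, 0 ≤ G j x) → (∀ j x, G j x ≤ 1) → ∀ M : ℝ, 0 ≤ M → (∀ j, 𝔼 x, G j x ≤ M) →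
    ∃ B : (∀ i : Fin N, L i) → ℝ,
      (∀ j (z : Fin N → ZMod 2) t, 𝔼 x : (∀ i : Fin N, L i), G j (fun i => T i (z i) (t i) (x i)) ≤ B t) ∧
      𝔼 t, B t ≤ 2 ^ n₀ * M + (1 / 2) ^ (k + n₀) := by
  intro N
  induction N with
  | zero =>
    intro k n₀ L _ _ T _ _ J _ _ _ G hG0 hG1 M hM0 hM
    refine ⟨fun _ => M, fun j z t => ?_, ?_⟩
    · refine le_trans (le_of_eq ?_) (hM j)
      exact Finset.expect_congr rfl fun x _ => congrArg _ (Subsingleton.elim _ _)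
    · rw [Fintype.expect_const]
      have : 1 ≤ (2 : ℝ) ^ n₀ := one_le_pow₀ (by norm_num)
      have : 0 < (1 / 2 : ℝ) ^ (k + n₀) := by positivity
      nlinarith
  | succ N ih =>
    intro k n₀ L _ _ T hT hT' J _ _ hJ G hG0 hG1 M hM0 hM
    let G₀ : J → L 0 → ℝ := fun j a => 𝔼 y : (∀ i : Fin N, L (i + 1)),
      G j (Fin.cons (α := fun i : Fin (N + 1) => L i) a y)
    have hG₀0 : ∀ j x, 0 ≤ G₀ j x := fun j x => Finset.expect_nonneg fun _ _ => hG0 _ _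
    have hG₀1 : ∀ j x, G₀ j x ≤ 1 := fun j x =>
      Finset.expect_le Finset.univ_nonempty fun _ _ => hG1 _ _
    have hG₀M : ∀ j, 𝔼 x, G₀ j x ≤ M := fun j => (expect_pi_succ (G j)).symm.le.trans (hM j)
    obtain ⟨n₁, B₀, hB₀, hB₀M⟩ : ∃ (n₁ : ℕ) (B₀ : L 0 → ℝ),
        (∀ j z t, 𝔼 x, G₀ j (T 0 z t x) ≤ B₀ t) ∧
        2 ^ n₁ * 𝔼 t, B₀ t + (1 / 2) ^ (k + 1 + n₁) ≤ 2 ^ n₀ * M + (1 / 2) ^ (k + n₀) := by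
      cases n₀ with
      | zero =>
        obtain ⟨B₀, h1, h2⟩ := hT 0 J G₀ hG₀0 hG₀1 M hG₀M
        refine ⟨0, B₀, h1, ?_⟩
        have hJ' : (Fintype.card J : ℝ) ≤ 2 ^ k := by exact_mod_cast hJ
        have h3 : (Fintype.card J : ℝ) * (1 / 2) ^ (2 * (k + 0) + 1) ≤ (1 / 2) ^ (k + 1) := by
          calc (Fintype.card J : ℝ) * (1 / 2) ^ (2 * (k + 0) + 1)
              ≤ 2 ^ k * (1 / 2) ^ (2 * (k + 0) + 1) := by gcongr
            _ = (2 * (1 / 2)) ^ k * (1 / 2) ^ (k + 1) := by rw [mul_pow]; ring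
            _ = _ := by norm_num
        have h4 : (1 / 2 : ℝ) ^ k = (1 / 2) ^ (k + 1) + (1 / 2) ^ (k + 1) := by ring
        simp only [pow_zero, one_mul, add_zero] at *
        linarith
      | succ n₁ =>
        refine ⟨n₁, fun _ => 2 * M, fun j z t => ?_, ?_⟩
        · exact (hT' 0 (G₀ j) (hG₀0 j) z t).trans (by linarith [hG₀M j])
        · rw [Fintype.expect_const, show k + 1 + n₁ = k + (n₁ + 1) by ring]
          apply le_of_eq; ring
    -- With the first shift `a` fixed, averaging out the first block leaves one function per pair of
    -- `j` and first bit of `z`, all of mean at most `B₀ a`.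
    have step : ∀ a : L 0, ∃ B : (∀ i : Fin N, L (i + 1)) → ℝ,
        (∀ (p : J × ZMod 2) (z : Fin N → ZMod 2) t,
          𝔼 y : (∀ i : Fin N, L (i + 1)), 𝔼 b : L 0,
            G p.1 (Fin.cons (α := fun i : Fin (N + 1) => L i) (T 0 p.2 a b)
              fun i : Fin N => T (i + 1) (z i) (t i) (y i)) ≤ B t) ∧
        𝔼 t, B t ≤ 2 ^ n₁ * B₀ a + (1 / 2) ^ (k + 1 + n₁) := by
      intro a
      have hJ2 : Fintype.card (J × ZMod 2) ≤ 2 ^ (k + 1) := by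
        rw [Fintype.card_prod, ZMod.card, pow_succ]; gcongr
      refine ih (k + 1) n₁ (L := fun n => L (n + 1)) (fun n => T (n + 1)) ?_ (fun n => hT' (n + 1))
        hJ2 (fun p y => 𝔼 b : L 0, G p.1 (Fin.cons (α := fun i : Fin (N + 1) => L i) (T 0 p.2 a b) y))
        (fun _ _ => Finset.expect_nonneg fun _ _ => hG0 _ _)
        (fun _ _ => Finset.expect_le Finset.univ_nonempty fun _ _ => hG1 _ _)
        (B₀ a) ?_ ?_
      · intro n J _ G h0 h1 M hM
        rw [show 2 * (k + 1 + n) + 1 = 2 * (k + (n + 1)) + 1 by ring]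
        exact hT (n + 1) J G h0 h1 M hM
      · let j : J := Classical.arbitrary J
        exact (Finset.expect_nonneg fun _ _ => hG₀0 _ _).trans (hB₀ j 0 a)
      · intro p
        rw [Finset.expect_comm]
        exact hB₀ p.1 p.2 a
    choose B hB hBM using step
    refine ⟨fun t => B (t 0) (Fin.tail t), fun j z t => ?_, ?_⟩
    · refine le_trans (le_of_eq ?_) (hB (t 0) (j, z 0) (Fin.tail z) (Fin.tail t))
      rw [expect_pi_succ, Finset.expect_comm]
      refine Finset.expect_congr rfl fun y _ => Finset.expect_congr rfl fun b _ => ?_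
      congr 1
      ext i
      refine Fin.cases ?_ (fun i => ?_) i <;> rfl
    · rw [expect_pi_succ]
      refine le_trans ?_ hB₀M
      calc _ ≤ 𝔼 a, (2 ^ n₁ * B₀ a + (1 / 2) ^ (k + 1 + n₁)) :=
            Finset.expect_le_expect fun a _ => hBM a
        _ = _ := by rw [Finset.expect_add_distrib, ← Finset.mul_expect, Fintype.expect_const]

/-! ### The measure and the block decomposition of the Cantor space -/

open Filter Topology

instance isProbabilityMeasure_uniformOn_zmod :
    IsProbabilityMeasure (ProbabilityTheory.uniformOn (Set.univ : Set (ZMod 2))) :=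
  ProbabilityTheory.isProbabilityMeasure_uniformOn Set.finite_univ Set.univ_nonempty

instance isProbabilityMeasure_cantorMeasure : IsProbabilityMeasure cantorMeasure := by
  unfold cantorMeasure; infer_instance

lemma map_add_uniformOn (a : ZMod 2) :
    (ProbabilityTheory.uniformOn (Set.univ : Set (ZMod 2))).map (a + ·) =
      ProbabilityTheory.uniformOn Set.univ := by
  ext s hs
  rw [Measure.map_apply (measurable_of_finite _) hs, ProbabilityTheory.uniformOn_univ,
    ProbabilityTheory.uniformOn_univ]
  congr 1
  rw [← Measure.count_injective_image (add_right_injective a),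
    Set.image_preimage_eq _ (add_left_surjective a)]

instance isAddLeftInvariant_cantorMeasure : cantorMeasure.IsAddLeftInvariant where
  map_add_left_eq_self a := by
    unfold cantorMeasure
    refine (Measure.infinitePi_map_pi _ (f := fun i x => a i + x)
      fun i => measurable_of_finite _).trans ?_
    simp only [map_add_uniformOn]

/-- The coordinates of the `n`-th block: two vectors of length `2 * n + 1` and a single bit. -/
abbrev BlockIndex (n : ℕ) : Type := (Fin (2 * n + 1) ⊕ Fin (2 * n + 1)) ⊕ Unit

/-- The group of values of the `n`-th block. -/
abbrev Block (n : ℕ) : Type :=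
  ((Fin (2 * n + 1) → ZMod 2) × (Fin (2 * n + 1) → ZMod 2)) × ZMod 2

/-- A partition of the coordinates of the Cantor space into blocks. -/
noncomputable def blockIndexEquiv : (Σ n, BlockIndex n) ≃ ℕ :=
  have : Infinite (Σ n, BlockIndex n) :=
    Infinite.of_injective (fun n : ℕ => (⟨n, Sum.inr ()⟩ : Σ n, BlockIndex n))
      fun _ _ h => congrArg Sigma.fst h
  (nonempty_equiv_of_countable (α := Σ n, BlockIndex n) (β := ℕ)).some

/-- A coordinate of a block. -/
def blockCoord {n : ℕ} (b : Block n) : BlockIndex n → ZMod 2 :=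
  Sum.elim (Sum.elim b.1.1 b.1.2) fun _ => b.2

/-- The decomposition of the Cantor space as a product of blocks. -/
noncomputable def blocks : CantorGroup ≃+ ∀ n, Block n where
  toFun x n := ((fun k => x (blockIndexEquiv ⟨n, Sum.inl (Sum.inl k)⟩),
    fun k => x (blockIndexEquiv ⟨n, Sum.inl (Sum.inr k)⟩)), x (blockIndexEquiv ⟨n, Sum.inr ()⟩))
  invFun y j := blockCoord (y (blockIndexEquiv.symm j).1) (blockIndexEquiv.symm j).2
  left_inv x := by
    funext j
    obtain ⟨⟨n, i⟩, rfl⟩ := blockIndexEquiv.surjective j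
    dsimp only
    rw [Equiv.symm_apply_apply]
    rcases i with (k | k) | k <;> rfl
  right_inv y := by
    have key : ∀ p : Σ n, BlockIndex n,
        blockCoord (y (blockIndexEquiv.symm (blockIndexEquiv p)).1)
          (blockIndexEquiv.symm (blockIndexEquiv p)).2 = blockCoord (y p.1) p.2 := fun p => by
      rw [Equiv.symm_apply_apply]
    funext n
    exact Prod.ext (Prod.ext (funext fun k => key ⟨n, Sum.inl (Sum.inl k)⟩)
      (funext fun k => key ⟨n, Sum.inl (Sum.inr k)⟩)) (key ⟨n, Sum.inr ()⟩)
  map_add' x y := rfl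

lemma continuous_blocks (n : ℕ) : Continuous fun x => blocks x n := by
  change Continuous fun x : CantorGroup =>
    (((fun k => x (blockIndexEquiv ⟨n, Sum.inl (Sum.inl k)⟩),
      fun k => x (blockIndexEquiv ⟨n, Sum.inl (Sum.inr k)⟩)),
      x (blockIndexEquiv ⟨n, Sum.inr ()⟩)) : Block n)
  fun_prop

lemma apply_eq_of_blocks_eq {x y : CantorGroup} {j : ℕ}
    (h : blocks x (blockIndexEquiv.symm j).1 = blocks y (blockIndexEquiv.symm j).1) :
    x j = y j := by
  have key : ∀ w : CantorGroup, w j = blockCoord (blocks w (blockIndexEquiv.symm j).1)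
    (blockIndexEquiv.symm j).2 := fun w => (congrFun (blocks.symm_apply_apply w) j).symm
  rw [key x, key y, h]

/-- The first `N` blocks of a point. -/
noncomputable def firstBlocks (N : ℕ) (x : CantorGroup) : ∀ i : Fin N, Block i :=
  fun i => blocks x i

lemma firstBlocks_add (N : ℕ) (x y : CantorGroup) :
    firstBlocks N (x + y) = firstBlocks N x + firstBlocks N y := rfl

lemma firstBlocks_surjective (N : ℕ) : Function.Surjective (firstBlocks N) := by
  intro s
  refine ⟨blocks.symm fun n => if h : n < N then s ⟨n, h⟩ else 0, ?_⟩
  funext i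
  simp [firstBlocks]

lemma measurable_firstBlocks (N : ℕ) : Measurable (firstBlocks N) :=
  measurable_pi_lambda _ fun i => (continuous_blocks i).measurable

/-- Translation invariance gives all cylinders over the first `N` blocks the same mass. -/
lemma lintegral_firstBlocks {N : ℕ} {f : (∀ i : Fin N, Block i) → ℝ} (hf : ∀ s, 0 ≤ f s) :
    ∫⁻ x, ENNReal.ofReal (f (firstBlocks N x)) ∂cantorMeasure = ENNReal.ofReal (𝔼 s, f s) := by
  have hm := measurable_firstBlocks N
  have hconst : ∀ s, cantorMeasure.map (firstBlocks N) {s} =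
      cantorMeasure (firstBlocks N ⁻¹' {0}) := by
    intro s
    obtain ⟨y, rfl⟩ := firstBlocks_surjective N s
    rw [Measure.map_apply hm (measurableSet_singleton _), ← measure_preimage_add cantorMeasure y]
    congr 1
    ext x
    simp [firstBlocks_add]
  have hF : ∀ F : (∀ i : Fin N, Block i) → ENNReal,
      ∫⁻ x, F (firstBlocks N x) ∂cantorMeasure =
        (∑ s, F s) * cantorMeasure (firstBlocks N ⁻¹' {0}) := by
    intro F
    rw [← lintegral_map (measurable_of_finite F) hm, lintegral_fintype, Finset.sum_mul]
    simp only [hconst]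
  have h1 := hF fun _ => 1
  simp only [lintegral_one, measure_univ, Finset.sum_const, nsmul_eq_mul, mul_one,
    Finset.card_univ] at h1
  rw [hF fun s => ENNReal.ofReal (f s), ENNReal.eq_inv_of_mul_eq_one_left ((mul_comm _ _).trans h1.symm),
    Fintype.expect_eq_sum_div_card, ENNReal.ofReal_div_of_pos (by exact_mod_cast Fintype.card_pos),
    ENNReal.ofReal_sum_of_nonneg fun s _ => hf s, ENNReal.ofReal_natCast, div_eq_mul_inv]

lemma measure_firstBlocks_preimage {N : ℕ} (A : Set (∀ i : Fin N, Block i)) :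
    cantorMeasure (firstBlocks N ⁻¹' A) = ENNReal.ofReal (𝔼 s, A.indicator (fun _ => (1 : ℝ)) s) := by
  rw [← lintegral_firstBlocks (Set.indicator_nonneg fun _ _ => zero_le_one),
    ← lintegral_indicator_one (measurable_firstBlocks N A.toFinite.measurableSet)]
  refine lintegral_congr fun x => ?_
  by_cases h : firstBlocks N x ∈ A <;> simp [h, Set.indicator]

/-! ### Null sets and translated fibres -/

/-- The point `x` moved to the fibre over `z` of the map `fibreMap`. -/
noncomputable def fibrePoint (z x : CantorGroup) : CantorGroup :=
  blocks.symm fun n => ((blocks x n).1, dotForm (blocks x n).1 + z n)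

/-- In each block `(v, c)`, add to the bit `c` the quadratic form of `v`. -/
noncomputable def fibreMap (x : CantorGroup) : CantorGroup :=
  fun n => (blocks x n).2 + dotForm (blocks x n).1

lemma fibreMap_fibrePoint (z x : CantorGroup) : fibreMap (fibrePoint z x) = z := by
  funext n
  simp only [fibreMap, fibrePoint, AddEquiv.apply_symm_apply]
  rw [add_right_comm, CharTwo.add_self_eq_zero, zero_add]

lemma continuous_fibreMap : Continuous fibreMap := by
  refine continuous_pi fun n => ?_
  exact (continuous_of_discreteTopology (f := fun b : Block n => b.2 + dotForm b.1)).comp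
    (continuous_blocks n)

lemma firstBlocks_add_fibrePoint (N : ℕ) (z t x : CantorGroup) :
    firstBlocks N (t + fibrePoint z x) = fun i : Fin N =>
      fibreShift dotForm (z i) (firstBlocks N t i) (firstBlocks N x i) := by
  funext i
  simp only [firstBlocks, fibrePoint, map_add, AddEquiv.apply_symm_apply, Pi.add_apply]
  rfl

lemma exists_bound_block (n : ℕ) (J : Type) [Fintype J] (G : J → Block n → ℝ)
    (hG0 : ∀ j x, 0 ≤ G j x) (hG1 : ∀ j x, G j x ≤ 1) (M : ℝ) (hM : ∀ j, 𝔼 x, G j x ≤ M) :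
    ∃ B : Block n → ℝ, (∀ j z t, 𝔼 x, G j (fibreShift dotForm z t x) ≤ B t) ∧
      𝔼 t, B t ≤ M + Fintype.card J * (1 / 2) ^ (2 * n + 1) := by
  refine exists_bound_fibreShift isBent_dotForm (by positivity) ?_ G hG0 hG1 hM
  simp only [Fintype.card_prod, Fintype.card_pi, ZMod.card, Finset.prod_const, Finset.card_univ,
    Fintype.card_fin, Nat.cast_mul, Nat.cast_pow, Nat.cast_ofNat]
  rw [sq, mul_mul_mul_comm, ← mul_pow]
  norm_num

lemma exists_bound_isOpen {U : Set CantorGroup} (hU : IsOpen U) {M : ℝ} (hM0 : 0 ≤ M)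
    (hM : cantorMeasure U ≤ ENNReal.ofReal M) (n : ℕ) :
    ∃ g : CantorGroup → ENNReal, Measurable g ∧
      (∀ t z, cantorMeasure {x | t + fibrePoint z x ∈ U} ≤ g t) ∧
      ∫⁻ t, g t ∂cantorMeasure ≤ ENNReal.ofReal (2 ^ n * M + (1 / 2) ^ n) := by
  -- `U` is exhausted by its cylinders on the first `N` blocks. The bound for these does not depend
  -- on `N`, so Fatou's lemma passes it to the liminf.
  let C : ∀ N : ℕ, Set (∀ i : Fin N, Block i) := fun N => {s | ∀ y, firstBlocks N y = s → y ∈ U}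
  have hCU : ∀ N, firstBlocks N ⁻¹' C N ⊆ U := fun N x hx => hx x rfl
  have hmono : Monotone fun N => firstBlocks N ⁻¹' C N := by
    intro N N' hN x hx y hy
    refine hx y ?_
    funext i
    exact congrFun hy (Fin.castLE hN i)
  have hUC : ⋃ N, firstBlocks N ⁻¹' C N = U := by
    refine (Set.iUnion_subset hCU).antisymm fun x hx => ?_
    obtain ⟨I, u, hu, hIU⟩ := isOpen_pi_iff.1 hU x hx
    refine Set.mem_iUnion.2 ⟨(I.sup fun j => (blockIndexEquiv.symm j).1) + 1, fun y hy => hIU ?_⟩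
    intro j hj
    have hlt : (blockIndexEquiv.symm j).1 < (I.sup fun j => (blockIndexEquiv.symm j).1) + 1 :=
      Nat.lt_succ_of_le (Finset.le_sup (f := fun j => (blockIndexEquiv.symm j).1) hj)
    rw [apply_eq_of_blocks_eq (x := y) (y := x) (congrFun hy ⟨_, hlt⟩)]
    exact (hu j hj).2
  have hB : ∀ N, ∃ B : (∀ i : Fin N, Block i) → ℝ,
      (∀ t z, cantorMeasure {x | t + fibrePoint z x ∈ firstBlocks N ⁻¹' C N} ≤
        ENNReal.ofReal (B (firstBlocks N t))) ∧
      ∫⁻ t, ENNReal.ofReal (B (firstBlocks N t)) ∂cantorMeasure ≤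
        ENNReal.ofReal (2 ^ n * M + (1 / 2) ^ n) := by
    intro N
    obtain ⟨B, hB, hBM⟩ := exists_bound_pi N 0 n (L := Block) (fun n => fibreShift dotForm)
      (fun n J _ G h0 h1 M hM => by
        rw [zero_add]; exact exists_bound_block n J G h0 h1 M hM)
      (fun n G hG z t => expect_fibreShift_le _ hG z t) (J := Unit) (by simp)
      (fun _ => (C N).indicator fun _ => 1) (fun _ => Set.indicator_nonneg fun _ _ => zero_le_one)
      (fun _ => Set.indicator_le_self' (fun _ _ => zero_le_one)) M hM0
      (fun _ => by
        rw [← ENNReal.ofReal_le_ofReal_iff hM0, ← measure_firstBlocks_preimage]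
        exact (measure_mono (hCU N)).trans hM)
    refine ⟨B, fun t z => ?_, ?_⟩
    · refine le_trans (le_of_eq ?_) (ENNReal.ofReal_le_ofReal
        (hB () (fun i => z i) (firstBlocks N t)))
      have := measure_firstBlocks_preimage {s : ∀ i : Fin N, Block i |
        (fun i : Fin N => fibreShift dotForm (z i) (firstBlocks N t i) (s i)) ∈ C N}
      simp only [Set.mem_preimage, firstBlocks_add_fibrePoint]
      exact this
    · rw [lintegral_firstBlocks fun t => ?_]
      · rw [zero_add] at hBM
        exact ENNReal.ofReal_le_ofReal hBM
      · exact (Finset.expect_nonneg fun _ _ => Set.indicator_nonneg (fun _ _ => zero_le_one) _).trans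
          (hB () 0 t)
  choose B hB hBM using hB
  have hmeas : ∀ N, Measurable fun t => ENNReal.ofReal (B N (firstBlocks N t)) := fun N =>
    (measurable_of_finite fun s => ENNReal.ofReal (B N s)).comp (measurable_firstBlocks N)
  refine ⟨fun t => liminf (fun N => ENNReal.ofReal (B N (firstBlocks N t))) atTop,
    Measurable.liminf hmeas, fun t z => ?_, ?_⟩
  · have hlim := tendsto_measure_iUnion_atTop (μ := cantorMeasure)
      (s := fun N => {x | t + fibrePoint z x ∈ firstBlocks N ⁻¹' C N})
      fun N N' hN x hx => hmono hN hx
    rw [show {x | t + fibrePoint z x ∈ U} =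
      ⋃ N, {x | t + fibrePoint z x ∈ firstBlocks N ⁻¹' C N} by
        rw [← hUC]; ext x; simp, ← hlim.liminf_eq]
    exact liminf_le_liminf (Eventually.of_forall fun N => hB N t z)
  · refine (lintegral_liminf_le hmeas).trans ?_
    refine (liminf_le_liminf (Eventually.of_forall hBM)).trans ?_
    rw [liminf_const]

theorem ae_forall_ae_add_fibrePoint_notMem {H : Set CantorGroup} (hH : IsNullSet H) :
    ∀ᵐ t ∂cantorMeasure, ∀ z, ∀ᵐ x ∂cantorMeasure, t + fibrePoint z x ∉ H := by
  have hg : ∀ n : ℕ, ∃ g : CantorGroup → ENNReal, Measurable g ∧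
      (∀ t z, cantorMeasure {x | t + fibrePoint z x ∈ H} ≤ g t) ∧
      ∫⁻ t, g t ∂cantorMeasure ≤ ENNReal.ofReal (2 * (1 / 2) ^ n) := by
    intro n
    -- Measure below `4^(-n)` absorbs the factor `2^n` lost on the first `n` blocks.
    obtain ⟨U, hHU, hU, hlt⟩ := H.exists_isOpen_lt_of_lt (μ := cantorMeasure)
      (ENNReal.ofReal ((1 / 4) ^ n)) (by rw [hH]; simp)
    obtain ⟨g, hg, h1, h2⟩ := exists_bound_isOpen hU (by positivity) hlt.le n
    refine ⟨g, hg, fun t z => (measure_mono (show {x | t + fibrePoint z x ∈ H} ⊆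
      {x | t + fibrePoint z x ∈ U} from fun x hx => hHU hx)).trans (h1 t z), h2.trans ?_⟩
    refine ENNReal.ofReal_le_ofReal (le_of_eq ?_)
    rw [← mul_pow]; norm_num; ring
  choose g hg hgH hgM using hg
  have h0 : ∫⁻ t, ⨅ n, g n t ∂cantorMeasure = 0 := by
    have hlim : Tendsto (fun n : ℕ => ENNReal.ofReal (2 * (1 / 2) ^ n)) atTop (𝓝 0) := by
      rw [← ENNReal.ofReal_zero]
      refine ENNReal.tendsto_ofReal ?_
      simpa using (tendsto_pow_atTop_nhds_zero_of_lt_one (r := (1 / 2 : ℝ)) (by norm_num)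
        (by norm_num)).const_mul 2
    refine le_antisymm (ge_of_tendsto' hlim fun n => ?_) bot_le
    exact (lintegral_mono fun t => iInf_le _ n).trans (hgM n)
  rw [lintegral_eq_zero_iff (Measurable.iInf hg)] at h0
  filter_upwards [h0] with t ht z
  rw [ae_iff]
  simp only [not_not]
  exact le_antisymm ((le_iInf fun n => hgH n t z).trans ht.le) bot_le

/-! ### Transfinite construction -/

/-- Transfinite recursion with choices: if for all values below `i` there is a value at `i` related
to all of them, then there is a function whose values are related at all pairs of arguments. -/
lemma exists_forall_lt_rel {I : Type*} [LinearOrder I] [WellFoundedLT I] {A : I → Type*}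
    (R : ∀ i, A i → (∀ j, j < i → A j) → Prop) (hR : ∀ i g, ∃ v, R i v g) :
    ∃ f : ∀ i, A i, ∀ i, R i (f i) fun j _ => f j := by
  choose v hv using hR
  refine ⟨WellFoundedLT.fix v, fun i => ?_⟩
  have := hv i fun j _ => WellFoundedLT.fix v j
  rwa [← WellFoundedLT.fix_eq v i] at this

lemma mk_measurableSet_cantorGroup : #{s : Set CantorGroup // MeasurableSet s} ≤ 𝔠 := by
  have : MeasurableSpace.CountablyGenerated CantorGroup := inferInstance
  obtain ⟨b, hb, hgen⟩ := this.isCountablyGenerated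
  rw [hgen]
  exact MeasurableSpace.cardinal_measurableSet_le_continuum (hb.le_aleph0.trans Cardinal.aleph0_le_continuum)

lemma isNullSet_setOf_add_mem {H : Set CantorGroup} (hH : IsNullSet H) (x : CantorGroup) :
    IsNullSet {t | t + x ∈ H} := by
  simp_rw [add_comm _ x]
  exact (measure_preimage_add cantorMeasure x H).trans hH

theorem exists_isStronglyMeager_image_eq_univ
    (h : ∀ 𝒜 : Set (Set CantorGroup), (∀ A ∈ 𝒜, IsNullSet A) → #𝒜 < 𝔠 → ⋃₀ 𝒜 ≠ Set.univ) :
    ∃ (X : Set CantorGroup) (F : CantorGroup → CantorGroup),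
      IsStronglyMeager X ∧ Continuous F ∧ F '' X = Set.univ := by
  let I : Type := (𝔠 : Cardinal.{0}).ord.ToType
  have hI : #I = 𝔠 := Cardinal.mk_ord_toType 𝔠
  have hIio : ∀ i : I, #(Set.Iio i) < 𝔠 := fun i => by
    simpa [I] using Cardinal.mk_Iio_lt i
  have hcov : ∀ {ι : Type} (A : ι → Set CantorGroup), #ι < 𝔠 → (∀ i, IsNullSet (A i)) →
      ∃ x, ∀ i, x ∉ A i := by
    intro ι A hι hA
    by_contra! hx
    refine h (Set.range A) (by rintro _ ⟨i, rfl⟩; exact hA i) (Cardinal.mk_range_le.trans_lt hι) ?_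
    exact Set.eq_univ_of_forall fun x => by simpa using hx x
  obtain ⟨z, hz⟩ : ∃ z : I → CantorGroup, Function.Surjective z := by
    have hc : #CantorGroup = 𝔠 := by simp [CantorGroup]
    obtain ⟨e⟩ := Cardinal.eq.1 (hI.trans hc.symm)
    exact ⟨e, e.surjective⟩
  obtain ⟨H, hH, hHcof⟩ : ∃ H : I → Set CantorGroup, (∀ i, IsNullSet (H i)) ∧
      ∀ A, IsNullSet A → ∃ i, A ⊆ H i := by
    let N := {s : {s : Set CantorGroup // MeasurableSet s} // IsNullSet s.1}
    have : Nonempty N := ⟨⟨⟨∅, MeasurableSet.empty⟩, measure_empty⟩⟩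
    have hN : #N ≤ #I := by
      rw [hI]; exact (Cardinal.mk_subtype_le _).trans mk_measurableSet_cantorGroup
    obtain ⟨e⟩ := hN
    refine ⟨fun i => (Function.invFun e i).1.1, fun i => (Function.invFun e i).2, fun A hA => ?_⟩
    let B : N := ⟨⟨toMeasurable cantorMeasure A, measurableSet_toMeasurable _ _⟩,
      (measure_toMeasurable A).trans hA⟩
    refine ⟨e B, ?_⟩
    dsimp only
    rw [Function.leftInverse_invFun e.injective B]
    exact subset_toMeasurable _ _
  obtain ⟨p, hp⟩ := exists_forall_lt_rel
    (A := fun i : I => CantorGroup ×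
      {t : CantorGroup // ∀ z, ∀ᵐ x ∂cantorMeasure, t + fibrePoint z x ∉ H i})
    (fun i v g => fibreMap v.1 = z i ∧ (∀ j hj, (g j hj).2.1 + v.1 ∉ H j) ∧
      (∀ j hj, v.2.1 + (g j hj).1 ∉ H i) ∧ v.2.1 + v.1 ∉ H i) (by
    intro i g
    obtain ⟨x, hx⟩ := hcov (fun j : Set.Iio i => {x | (g j j.2).2.1 + fibrePoint (z i) x ∈ H j})
      (hIio i) fun j => by simpa [ae_iff, IsNullSet] using (g j j.2).2.2 (z i)
    set y := fibrePoint (z i) x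
    -- `none` stands for the translations that are bad for `H i`, `some none` for the new point `y`,
    -- and the remaining indices for earlier points.
    obtain ⟨t, ht⟩ := hcov (fun o : Option (Option (Set.Iio i)) => o.elim
        {t | ¬ ∀ z, ∀ᵐ x ∂cantorMeasure, t + fibrePoint z x ∉ H i}
        fun o => {t | t + o.elim y (fun j => (g j j.2).1) ∈ H i})
      (by
        rw [Cardinal.mk_option, Cardinal.mk_option]
        have h1 := Cardinal.one_lt_aleph0.trans_le Cardinal.aleph0_le_continuum
        have h0 := Cardinal.aleph0_le_continuum
        exact Cardinal.add_lt_of_lt h0 (Cardinal.add_lt_of_lt h0 (hIio i) h1) h1)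
      (by
        rintro (_ | o)
        · exact ae_iff.1 (ae_forall_ae_add_fibrePoint_notMem (hH i))
        · exact isNullSet_setOf_add_mem (hH i) _)
    refine ⟨(y, ⟨t, by simpa using ht none⟩), fibreMap_fibrePoint _ _, fun j hj => hx ⟨j, hj⟩,
      fun j hj => ht (some (some ⟨j, hj⟩)), ht (some none)⟩)
  refine ⟨Set.range fun i => (p i).1, fibreMap, fun A hA hXA => ?_, continuous_fibreMap, ?_⟩
  · obtain ⟨i, hi⟩ := hHcof A hA
    have hmem : (p i).2.1 ∈ (Set.range fun i => (p i).1) + A := by rw [hXA]; trivial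
    obtain ⟨_, ⟨j, rfl⟩, a, ha, hja⟩ := Set.mem_add.1 hmem
    -- In characteristic 2, `t = x + a` gives `t + x = a`.
    have haH : (p i).2.1 + (p j).1 ∈ H i := by
      refine hi ?_
      rw [← hja, add_right_comm, CharTwo.add_self_eq_zero, zero_add]
      exact ha
    rcases lt_trichotomy i j with hij | rfl | hij
    · exact (hp j).2.1 i hij haH
    · exact (hp i).2.2.2 haH
    · exact (hp i).2.2.1 j hij haH
  · refine Set.eq_univ_of_forall fun w => ?_
    obtain ⟨i, rfl⟩ := hz w
    exact ⟨_, ⟨i, rfl⟩, (hp i).1⟩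

theorem mainTheorem1 :
    (covNull = 𝔠 →
      ∃ (X : Set CantorGroup) (F : CantorGroup → CantorGroup),
        IsStronglyMeager X ∧ Continuous F ∧ F '' X = Set.univ) ∧
    ((ℵ₁ : Cardinal.{0}) = 𝔠 →
      ∃ (X : Set CantorGroup) (F : CantorGroup → CantorGroup),
        IsStronglyMeager X ∧ Continuous F ∧ F '' X = Set.univ) := by
  refine ⟨fun hc => exists_isStronglyMeager_image_eq_univ fun 𝒜 h𝒜 hlt hU => ?_,
    fun hc => exists_isStronglyMeager_image_eq_univ fun 𝒜 h𝒜 hlt hU => ?_⟩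
  · rw [← hc] at hlt
    exact hlt.not_ge (csInf_le' ⟨𝒜, h𝒜, hU, rfl⟩)
  -- Under CH a family smaller than `𝔠` is countable, so its union is null.
  · rw [← hc, ← Cardinal.succ_aleph0, Order.lt_succ_iff, Cardinal.le_aleph0_iff_set_countable] at hlt
    have h0 : cantorMeasure (⋃₀ 𝒜) = 0 := (measure_sUnion_null_iff hlt).2 h𝒜
    rw [hU, measure_univ] at h0
    exact one_ne_zero h0
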